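/- Let $d\ge 0$ be an integer, let $\kappa=(\kappa_1,\dots,\kappa_{d+1})$ with $\kappa_i\ge 0$ for all $i$, and let $S^d=\{x\in\mathbb R^{d+1}:\|x\|=1\}$ with surface measure $d\omega$. Put $h_\kappa(x)=\prod_{i=1}^{d+1}|x_i|^{\kappa_i}$. Let $V_\kappa$ be the intertwining operator of the group $\mathbb Z_2^{d+1}$, $$V_\kappa g(x)=c_\kappa\int_{[-1,1]^{d+1}} g(x_1t_1,\dots,x_{d+1}t_{d+1})\prod_{i=1}^{d+1}(1+t_i)(1-t_i^2)^{\kappa_i-1}\,dt,$$ where $c_\kappa$ is determined by $V_\kappa 1=1$; if $\kappa_i=0$, the normalized measure in the variable $t_i$ is replaced by its limit as $\kappa_i\to0^+$, the unit mass at $t_i=1$. For $x\in S^d$ and $0<\theta\le\pi$ let $$c(x,\theta)=\{y\in S^d:\langle x,y\rangle\ge\cos\theta\},\qquad B(x,\theta)=\{y\in\mathbb R^{d+1}:\|y\|\le 1,\ \langle x,y\rangle\ge\cos\theta\},$$ and for $f\in L^1(h_\kappa^2\,d\omega;S^d)$ (real- or complex-valued) define, with values in $[0,\infty]$, $$\mathcal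 M_\kappa f(x)=\sup_{0<\theta\le\pi}\frac{\int_{S^d}|f(y)|\,V_\kappa[\chi_{B(x,\theta)}](y)\,h_\kappa^2(y)\,d\omega(y)}{\int_{S^d}V_\kappa[\chi_{B(x,\theta)}](y)\,h_\kappa^2(y)\,d\omega(y)},\qquad M_\kappa f(x)=\sup_{0<\theta\le\pi}\frac{\int_{c(x,\theta)}|f(y)|\,h_\kappa^2(y)\,d\omega(y)}{\int_{c(x,\theta)}h_\kappa^2(y)\,d\omega(y)}.$$ Then there is a finite constant $c$, depending only on $d$ and $\kappa$, such that for every $f\in L^1(h_\kappa^2\,d\omega;S^d)$ and every $x\in S^d$, $$\mathcal M_\kappa f(x)\le c\sum_{\varepsilon\in\{1,-1\}^{d+1}}M_\kappa f(x\varepsilon),\qquad x\varepsilon=(x_1\varepsilon_1,\dots,x_{d+1}\varepsilon_{d+1}).$$ -/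

import Mathlib

open MeasureTheory Set
open scoped ENNReal NNReal

noncomputable section

namespace ProductWeight

/-- The unit sphere `S^d` of `ℝ^{d+1}`. -/
abbrev Sph (d : ℕ) : Type := Metric.sphere (0 : EuclideanSpace ℝ (Fin (d + 1))) 1

/-- The surface (Lebesgue) measure `dω` on `S^d`. -/
def surfaceMeasure (d : ℕ) : Measure (Sph d) :=
  (volume : Measure (EuclideanSpace ℝ (Fin (d + 1)))).toSphere

variable {d : ℕ}

/-- The product weight `h_κ(x) = ∏ i, |x_i| ^ κ_i` (with `|x_i| ^ 0 = 1`). -/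
def weight (κ : Fin (d + 1) → ℝ) (x : EuclideanSpace ℝ (Fin (d + 1))) : ℝ :=
  ∏ i, |x i| ^ κ i

/-- The measure `h_κ² dω` on `S^d`. -/
def weightedMeasure (κ : Fin (d + 1) → ℝ) : Measure (Sph d) :=
  (surfaceMeasure d).withDensity fun y => ENNReal.ofReal (weight κ y ^ 2)

/-- The measure `(1 + t) (1 - t²) ^ (k - 1) dt` on `[-1, 1]`, not normalized. -/
def jacobiMeasure (k : ℝ) : Measure ℝ :=
  (volume.restrict (Icc (-1) 1)).withDensity
    fun t => ENNReal.ofReal ((1 + t) * (1 - t ^ 2) ^ (k - 1))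

/-- The one-dimensional factor of the intertwining operator: the probability measure proportional
to `(1 + t) (1 - t²) ^ (k - 1) dt` on `[-1, 1]` if `k > 0`, and its limit as `k → 0`, the unit
mass at `1`, if `k = 0`. -/
def intertwiningFactor (k : ℝ) : Measure ℝ :=
  if k = 0 then Measure.dirac 1 else (jacobiMeasure k univ)⁻¹ • jacobiMeasure k

/-- The intertwining operator `V_κ` of the group `ℤ₂^{d+1}`:
`V_κ g(x) = c_κ ∫_{[-1,1]^{d+1}} g(x₁t₁, …, x_{d+1}t_{d+1}) ∏ i, (1 + t_i)(1 - t_i²)^{κ_i - 1} dt`,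
where `V_κ 1 = 1`. -/
def intertwining (κ : Fin (d + 1) → ℝ) (g : EuclideanSpace ℝ (Fin (d + 1)) → ℝ)
    (x : EuclideanSpace ℝ (Fin (d + 1))) : ℝ :=
  ∫ t : Fin (d + 1) → ℝ, g (WithLp.toLp 2 fun i => x i * t i)
    ∂Measure.pi fun i => intertwiningFactor (κ i)

/-- The spherical cap `c(x, θ) = {y ∈ S^d : ⟨x, y⟩ ≥ cos θ}`. -/
def cap (x : Sph d) (θ : ℝ) : Set (Sph d) :=
  {y | Real.cos θ ≤ inner ℝ (x : EuclideanSpace ℝ (Fin (d + 1))) y}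

/-- The solid cap `B(x, θ) = {y ∈ B^{d+1} : ⟨x, y⟩ ≥ cos θ}`. -/
def solidCap (x : Sph d) (θ : ℝ) : Set (EuclideanSpace ℝ (Fin (d + 1))) :=
  {y | ‖y‖ ≤ 1 ∧ Real.cos θ ≤ inner ℝ (x : EuclideanSpace ℝ (Fin (d + 1))) y}

/-- `V_κ[χ_{B(x,θ)}](y)`, a number of `[0, 1]`, as an extended nonnegative real. -/
def capKernel (κ : Fin (d + 1) → ℝ) (x : Sph d) (θ : ℝ) (y : Sph d) : ℝ≥0∞ :=
  ENNReal.ofReal (intertwining κ ((solidCap x θ).indicator fun _ => (1 : ℝ)) y)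

/-- The maximal function `𝓜_κ f` defined through the intertwining operator. It may be infinite. -/
def intertwiningMaximal {𝕜 : Type*} [RCLike 𝕜] (κ : Fin (d + 1) → ℝ) (f : Sph d → 𝕜)
    (x : Sph d) : ℝ≥0∞ :=
  ⨆ θ ∈ Ioc (0 : ℝ) Real.pi,
    (∫⁻ y, ‖f y‖ₑ * capKernel κ x θ y ∂weightedMeasure κ) /
      ∫⁻ y, capKernel κ x θ y ∂weightedMeasure κ

/-- The weighted Hardy–Littlewood maximal function `M_κ f`. It may be infinite. -/
def hlMaximal {𝕜 : Type*} [RCLike 𝕜] (κ : Fin (d + 1) → ℝ) (f : Sph d → 𝕜)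
    (x : Sph d) : ℝ≥0∞ :=
  ⨆ θ ∈ Ioc (0 : ℝ) Real.pi,
    (∫⁻ y in cap x θ, ‖f y‖ₑ ∂weightedMeasure κ) / weightedMeasure κ (cap x θ)

/-- The action `xε = (x₁ε₁, …, x_{d+1}ε_{d+1})` of a sign vector `ε` on `S^d`. -/
def signChange (x : Sph d) (ε : Fin (d + 1) → ℤˣ) : Sph d :=
  ⟨WithLp.toLp 2 fun i => (x : EuclideanSpace ℝ (Fin (d + 1))) i * ((ε i : ℤ) : ℝ), by
    have hx : ‖(x : EuclideanSpace ℝ (Fin (d + 1)))‖ = 1 := by simp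
    have hε : ∀ i, (((ε i : ℤ) : ℝ)) ^ 2 = 1 := fun i => by
      rcases Int.units_eq_one_or (ε i) with h | h <;> simp [h]
    refine mem_sphere_zero_iff_norm.2 (Eq.trans ?_ hx)
    rw [EuclideanSpace.norm_eq, EuclideanSpace.norm_eq]
    simp [mul_pow, hε]⟩

end ProductWeight

end

/-! With `r = 2 sin (θ/2)`, the cap `c(x, θ)` is the chordal ball of radius `r` and `cos θ = 1 -
r²/2`. Put `P = ∏ (r / (|x_i| + r))^(2κ_i)`. Three facts give the theorem. The kernel `V_κ[χ_B](y)`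
vanishes unless `y` lies in the cap about some `xε`, and it is everywhere at most a constant times
`P` (`capKernel_le`): a parameter `t` that counts has each `1 - |t_i|` of order at most `(r / (|x_i|
+ r))²`. On the ball of radius `r/2` about `x` the kernel is at least a constant times `P`
(`le_capKernel`), since a box of parameters near `(1, …, 1)` counts. The weighted mass of a ball of
radius `r ≤ 2` is comparable to `r^d ∏ (|x_i| + r)^(2κ_i)`, which sees only the `|x_i|`; so the ball
of radius `r` about any `xε` is controlled by the ball of radius `r/2` about `x`
(`weightedMeasure_closedBall_le_half`). The numerator is then at most a constant times `P` times
that half-ball mass times the sum of the `M_κ f(xε)`, and `P` times the half-ball mass is at most a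
constant times the denominator. -/

noncomputable section

namespace ProductWeight

open scoped Pointwise

variable {d : ℕ}

/-! ### Surface measure of balls, by comparing volumes of cones -/

/-- The open cone of height one over a subset of the sphere. -/
def solidCone (s : Set (Sph d)) : Set (EuclideanSpace ℝ (Fin (d + 1))) :=
  Ioo (0 : ℝ) 1 • ((↑) '' s)

lemma mem_solidCone {s : Set (Sph d)} {v : EuclideanSpace ℝ (Fin (d + 1))} :
    v ∈ solidCone s ↔ ∃ a : ℝ, 0 < a ∧ a < 1 ∧ ∃ y ∈ s,
      v = a • (y : EuclideanSpace ℝ (Fin (d + 1))) := by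
  simp only [solidCone, Set.mem_smul, mem_image, mem_Ioo]
  constructor
  · rintro ⟨a, ⟨h0, h1⟩, _, ⟨y, hy, rfl⟩, rfl⟩
    exact ⟨a, h0, h1, y, hy, rfl⟩
  · rintro ⟨a, h0, h1, y, hy, rfl⟩
    exact ⟨a, ⟨h0, h1⟩, _, ⟨y, hy, rfl⟩, rfl⟩

lemma solidCone_subset_ball (s : Set (Sph d)) : solidCone s ⊆ Metric.ball 0 1 := by
  intro v hv
  obtain ⟨a, h0, h1, y, -, rfl⟩ := mem_solidCone.1 hv
  simp [norm_smul, abs_of_pos h0, h1]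

lemma volume_solidCone_ne_top (s : Set (Sph d)) : volume (solidCone s) ≠ ∞ :=
  ((measure_mono (solidCone_subset_ball s)).trans_lt measure_ball_lt_top).ne

lemma surfaceMeasure_eq_solidCone {s : Set (Sph d)} (hs : MeasurableSet s) :
    surfaceMeasure d s = (d + 1 : ℕ) * volume (solidCone s) := by
  rw [surfaceMeasure, Measure.toSphere_apply' _ hs]
  simp [solidCone]

lemma volume_smul_solidCone {a : ℝ} (ha : 0 ≤ a) (s : Set (Sph d)) :
    volume (a • solidCone s) = ENNReal.ofReal (a ^ (d + 1)) * volume (solidCone s) := by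
  rw [Measure.addHaar_smul]
  simp [abs_of_nonneg ha]

lemma norm_coe_sphere (x : Sph d) : ‖(x : EuclideanSpace ℝ (Fin (d + 1)))‖ = 1 := by simp

instance isFiniteMeasure_surfaceMeasure : IsFiniteMeasure (surfaceMeasure d) := by
  unfold surfaceMeasure; infer_instance

/-- A point `a • y` of the cone with `a ≥ 1 - r` is within `r` of `y`, hence within `2 * r` of `x`;
lower points lie in the shrunken cone. -/
lemma solidCone_closedBall_subset (x : Sph d) (r : ℝ) :
    solidCone (Metric.closedBall x r) ⊆
      (1 - r) • solidCone (Metric.closedBall x r) ∪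
        Metric.closedBall (x : EuclideanSpace ℝ (Fin (d + 1))) (2 * r) := by
  intro v hv
  obtain ⟨a, h0, h1, y, hy, rfl⟩ := mem_solidCone.1 hv
  by_cases har : a < 1 - r
  · left
    have h1r : 0 < 1 - r := by linarith
    refine mem_smul_set.2 ⟨(a / (1 - r)) • (y : EuclideanSpace ℝ (Fin (d + 1))),
      mem_solidCone.2 ⟨_, div_pos h0 h1r, (div_lt_one h1r).2 har, y, hy, rfl⟩, ?_⟩
    rw [smul_smul, mul_div_cancel₀ _ h1r.ne']
  · right
    have hyx : dist (y : EuclideanSpace ℝ (Fin (d + 1))) x ≤ r := hy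
    have : dist (a • (y : EuclideanSpace ℝ (Fin (d + 1)))) y ≤ r := by
      rw [dist_eq_norm, show a • (y : EuclideanSpace ℝ (Fin (d + 1))) - y =
          (a - 1) • (y : EuclideanSpace ℝ (Fin (d + 1))) by
        rw [sub_smul, one_smul], norm_smul, norm_coe_sphere, Real.norm_eq_abs, mul_one, abs_le]
      constructor <;> linarith
    rw [Metric.mem_closedBall]
    linarith [dist_triangle (a • (y : EuclideanSpace ℝ (Fin (d + 1)))) y x]

/-- A point within `r` of `z` has norm between `1 - r` and `1 + r`, and its radial projection moves
it by at most `r`, so the projection stays within `2 * r` of `z`. -/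
lemma ball_union_smul_solidCone_subset (z : Sph d) {r : ℝ} (hr0 : 0 < r) (hr : r < 1) :
    Metric.ball (z : EuclideanSpace ℝ (Fin (d + 1))) r ∪
      (1 - r) • solidCone (Metric.closedBall z (2 * r)) ⊆
        (1 + r) • solidCone (Metric.closedBall z (2 * r)) := by
  rintro v (hv | hv)
  · have hvz : ‖v - z‖ < r := by simpa [dist_eq_norm] using hv
    have h1 : |‖v‖ - 1| < r := by
      have := abs_norm_sub_norm_le v (z : EuclideanSpace ℝ (Fin (d + 1)))
      rw [norm_coe_sphere] at this
      linarith
    rw [abs_lt] at h1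
    have hv0 : 0 < ‖v‖ := by linarith
    have h1r : 0 < 1 + r := by linarith
    let y : Sph d := ⟨‖v‖⁻¹ • v, by simp [norm_smul, hv0.ne']⟩
    have hvy : v = ‖v‖ • (y : EuclideanSpace ℝ (Fin (d + 1))) := by
      simp [y, smul_smul, hv0.ne']
    refine mem_smul_set.2 ⟨(‖v‖ / (1 + r)) • (y : EuclideanSpace ℝ (Fin (d + 1))),
      mem_solidCone.2 ⟨_, div_pos hv0 h1r, (div_lt_one h1r).2 (by linarith), y, ?_, rfl⟩, ?_⟩
    · have hyv : ‖(y : EuclideanSpace ℝ (Fin (d + 1))) - v‖ ≤ r := by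
        rw [show (y : EuclideanSpace ℝ (Fin (d + 1))) - v =
            (1 - ‖v‖) • (y : EuclideanSpace ℝ (Fin (d + 1))) by
          rw [sub_smul, one_smul, ← hvy], norm_smul, norm_coe_sphere, Real.norm_eq_abs, mul_one,
          abs_le]
        constructor <;> linarith
      rw [Metric.mem_closedBall, Subtype.dist_eq, dist_eq_norm]
      have := norm_add_le ((y : EuclideanSpace ℝ (Fin (d + 1))) - v) (v - z)
      rw [sub_add_sub_cancel] at this
      linarith
    · rw [smul_smul, mul_div_cancel₀ _ h1r.ne', ← hvy]
  · obtain ⟨w, hw, rfl⟩ := mem_smul_set.1 hv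
    obtain ⟨a, h0, h1, y, hy, rfl⟩ := mem_solidCone.1 hw
    have h1r : 0 < 1 + r := by linarith
    refine mem_smul_set.2 ⟨((1 - r) * a / (1 + r)) • (y : EuclideanSpace ℝ (Fin (d + 1))),
      mem_solidCone.2 ⟨_, div_pos (mul_pos (by linarith) h0) h1r,
        (div_lt_one h1r).2 (by nlinarith), y, hy, rfl⟩, ?_⟩
    rw [smul_smul, mul_div_cancel₀ _ h1r.ne', smul_smul]

lemma disjoint_ball_smul_solidCone (z : Sph d) {r : ℝ} (hr : r < 1) (s : Set (Sph d)) :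
    Disjoint (Metric.ball (z : EuclideanSpace ℝ (Fin (d + 1))) r) ((1 - r) • solidCone s) := by
  rw [Set.disjoint_left]
  intro v hv hv'
  obtain ⟨w, hw, rfl⟩ := mem_smul_set.1 hv'
  have hw1 : ‖w‖ < 1 := by simpa using solidCone_subset_ball s hw
  have h1 := abs_norm_sub_norm_le ((1 - r) • w) (z : EuclideanSpace ℝ (Fin (d + 1)))
  rw [Metric.mem_ball, dist_eq_norm] at hv
  rw [norm_coe_sphere, norm_smul, Real.norm_eq_abs, abs_of_pos (by linarith : 0 < 1 - r)] at h1
  have h2 := (abs_le.1 h1).1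
  nlinarith

lemma volume_closedBall_eq (x : EuclideanSpace ℝ (Fin (d + 1))) {r : ℝ} (hr : 0 ≤ r) :
    volume (Metric.closedBall x r) = ENNReal.ofReal (r ^ (d + 1)) *
      volume (Metric.ball (0 : EuclideanSpace ℝ (Fin (d + 1))) 1) := by
  rw [Measure.addHaar_closedBall _ _ hr]; simp

lemma surfaceMeasure_closedBall_le (d : ℕ) : ∃ C : ℝ≥0, ∀ x : Sph d, ∀ r : ℝ, 0 < r →
    surfaceMeasure d (Metric.closedBall x r) ≤ C * ENNReal.ofReal (r ^ d) := by
  set b := (volume (Metric.ball (0 : EuclideanSpace ℝ (Fin (d + 1))) 1)).toNNReal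
  have hbv : volume (Metric.ball (0 : EuclideanSpace ℝ (Fin (d + 1))) 1) = b :=
    (ENNReal.coe_toNNReal measure_ball_lt_top.ne).symm
  set S := (surfaceMeasure d univ).toNNReal
  have hS : surfaceMeasure d univ = S := (ENNReal.coe_toNNReal (measure_ne_top _ _)).symm
  refine ⟨S + (d + 1 : ℕ) * (2 ^ (d + 1) * b), fun x r hr => ?_⟩
  rcases le_or_gt 1 r with h1 | h1
  · calc _ ≤ (S : ℝ≥0∞) * 1 := by rw [mul_one, ← hS]; exact measure_mono (subset_univ _)
      _ ≤ _ := by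
        gcongr
        · exact le_self_add
        · exact ENNReal.one_le_ofReal.2 (one_le_pow₀ h1)
  · set A := solidCone (Metric.closedBall x r) with hA
    have hle : volume A ≤ ENNReal.ofReal ((1 - r) ^ (d + 1)) * volume A +
        ENNReal.ofReal ((2 * r) ^ (d + 1)) * b := by
      calc volume A ≤ _ := measure_mono (solidCone_closedBall_subset x r)
        _ ≤ _ := measure_union_le _ _
        _ = _ := by rw [volume_smul_solidCone (by linarith), volume_closedBall_eq _ (by linarith), hbv]
    set a := (volume A).toNNReal
    have ha : volume A = a := (ENNReal.coe_toNNReal (volume_solidCone_ne_top _)).symm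
    have h1r : 0 ≤ 1 - r := by linarith
    have hreal : (a : ℝ) ≤ (1 - r) ^ (d + 1) * a + (2 * r) ^ (d + 1) * b := by
      rw [ha] at hle
      have := ENNReal.toReal_mono (by finiteness) hle
      rwa [ENNReal.toReal_add (by finiteness) (by finiteness), ENNReal.toReal_mul,
        ENNReal.toReal_mul, ENNReal.toReal_ofReal (by positivity),
        ENNReal.toReal_ofReal (by positivity)] at this
    -- The shell removed by shrinking keeps at least a fraction `r` of the cone, so `a * r ≤ (2 * r)
    -- ^ (d + 1) * b`; cancelling `r` leaves the exponent `d`.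
    have hp : (1 - r) ^ (d + 1) ≤ 1 - r := pow_le_of_le_one h1r (by linarith) (by simp)
    have hfin : (a : ℝ) ≤ 2 ^ (d + 1) * b * r ^ d := by
      have ha0 : (0 : ℝ) ≤ a := a.2
      have h2 : (a : ℝ) * r ≤ (2 ^ (d + 1) * b * r ^ d) * r := by
        have := mul_le_mul_of_nonneg_right hp ha0
        have e : (2 ^ (d + 1) * (b : ℝ) * r ^ d) * r = (2 * r) ^ (d + 1) * b := by ring
        rw [e]; linarith
      exact le_of_mul_le_mul_right h2 hr
    rw [surfaceMeasure_eq_solidCone Metric.isClosed_closedBall.measurableSet, ← hA, ha]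
    calc ((d + 1 : ℕ) : ℝ≥0∞) * a
        ≤ ((d + 1 : ℕ) : ℝ≥0∞) * ((2 ^ (d + 1) * b : ℝ≥0) * ENNReal.ofReal (r ^ d)) := by
          gcongr
          rw [← ENNReal.ofReal_coe_nnreal, ← ENNReal.ofReal_coe_nnreal,
            ← ENNReal.ofReal_mul (by positivity)]
          exact ENNReal.ofReal_le_ofReal (by push_cast; exact hfin)
      _ = ((d + 1 : ℕ) * (2 ^ (d + 1) * b) : ℝ≥0) * ENNReal.ofReal (r ^ d) := by
          rw [← mul_assoc]; push_cast; rfl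
      _ ≤ _ := by gcongr; exact le_add_self

lemma one_add_pow_le {r : ℝ} (h0 : 0 ≤ r) (h1 : r ≤ 1) (n : ℕ) :
    (1 + r) ^ n ≤ 1 + (2 ^ n - 1) * r := by
  induction n with
  | zero => simp
  | succ n ih =>
    have h2 : (1 : ℝ) ≤ 2 ^ n := one_le_pow₀ (by norm_num)
    calc (1 + r) ^ (n + 1) = (1 + r) ^ n * (1 + r) := pow_succ _ _
      _ ≤ (1 + (2 ^ n - 1) * r) * (1 + r) := by gcongr
      _ ≤ 1 + (2 ^ (n + 1) - 1) * r := by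
        rw [pow_succ]
        nlinarith [mul_nonneg (mul_nonneg h0 (sub_nonneg.2 h1)) (sub_nonneg.2 h2)]

/-- The solid ball and the inner cone are disjoint inside the outer cone, so the shell, of volume
`((1 + r)^(d+1) - (1 - r)^(d+1)) * a = O(r a)`, has room for a ball of volume `r^(d+1) * b`. -/
lemma le_surfaceMeasure_closedBall (d : ℕ) : ∃ C : ℝ≥0, ∀ z : Sph d, ∀ r : ℝ, 0 < r → r < 1 →
    ENNReal.ofReal (r ^ d) ≤ C * surfaceMeasure d (Metric.closedBall z (2 * r)) := by
  set b := (volume (Metric.ball (0 : EuclideanSpace ℝ (Fin (d + 1))) 1)).toNNReal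
  have hbv : volume (Metric.ball (0 : EuclideanSpace ℝ (Fin (d + 1))) 1) = b :=
    (ENNReal.coe_toNNReal measure_ball_lt_top.ne).symm
  have hb0 : (0 : ℝ) < b :=
    ENNReal.toNNReal_pos (Metric.measure_ball_pos _ _ one_pos).ne' measure_ball_lt_top.ne
  refine ⟨(2 ^ (d + 1) + (d + 1 : ℕ)) / b, fun z r hr hr1 => ?_⟩
  set A := solidCone (Metric.closedBall z (2 * r)) with hA
  have h1r : 0 ≤ 1 - r := by linarith
  have hle : ENNReal.ofReal (r ^ (d + 1)) * b + ENNReal.ofReal ((1 - r) ^ (d + 1)) * volume A ≤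
      ENNReal.ofReal ((1 + r) ^ (d + 1)) * volume A := by
    rw [← volume_smul_solidCone h1r, ← volume_smul_solidCone (by linarith), ← hbv,
      ← volume_closedBall_eq (z : EuclideanSpace ℝ (Fin (d + 1))) hr.le,
      Measure.addHaar_closedBall_eq_addHaar_ball,
      ← measure_union' (disjoint_ball_smul_solidCone z hr1 _) measurableSet_ball]
    exact measure_mono (ball_union_smul_solidCone_subset z hr hr1)
  set a := (volume A).toNNReal
  have ha : volume A = a := (ENNReal.coe_toNNReal (volume_solidCone_ne_top _)).symm
  have ha0 : (0 : ℝ) ≤ a := a.2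
  have hreal : r ^ (d + 1) * b + (1 - r) ^ (d + 1) * a ≤ (1 + r) ^ (d + 1) * a := by
    rw [ha] at hle
    have := ENNReal.toReal_mono (by finiteness) hle
    rwa [ENNReal.toReal_add (by finiteness) (by finiteness), ENNReal.toReal_mul,
      ENNReal.toReal_mul, ENNReal.toReal_mul, ENNReal.toReal_ofReal (by positivity),
      ENNReal.toReal_ofReal (by positivity), ENNReal.toReal_ofReal (by positivity)] at this
  have hup := mul_le_mul_of_nonneg_right (one_add_pow_le hr.le hr1.le (d + 1)) ha0
  have hlow := mul_le_mul_of_nonneg_right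
    (one_add_mul_le_pow (by linarith : (-2 : ℝ) ≤ -r) (d + 1)) ha0
  rw [← sub_eq_add_neg] at hlow
  have hfin : r ^ d * b ≤ (2 ^ (d + 1) + (d + 1 : ℕ)) * a := by
    have h2 : r ^ d * b * r ≤ ((2 ^ (d + 1) + (d + 1 : ℕ)) * a) * r := by
      have e : r ^ d * b * r = r ^ (d + 1) * b := by ring
      rw [e]; nlinarith [mul_nonneg hr.le ha0]
    exact le_of_mul_le_mul_right h2 hr
  rw [surfaceMeasure_eq_solidCone Metric.isClosed_closedBall.measurableSet, ← hA, ha]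
  calc ENNReal.ofReal (r ^ d)
      ≤ ENNReal.ofReal (((2 ^ (d + 1) + (d + 1 : ℕ)) / b : ℝ≥0) * a) := by
        refine ENNReal.ofReal_le_ofReal ?_
        push_cast at hfin ⊢
        rw [div_mul_eq_mul_div, le_div_iff₀ hb0]
        exact hfin
    _ = ((2 ^ (d + 1) + (d + 1 : ℕ)) / b : ℝ≥0) * (1 * (a : ℝ≥0∞)) := by
        rw [ENNReal.ofReal_mul (by positivity), ENNReal.ofReal_coe_nnreal,
          ENNReal.ofReal_coe_nnreal, one_mul]
    _ ≤ _ := by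
        gcongr
        exact_mod_cast Nat.succ_le_succ (Nat.zero_le d)

/-! ### The one-dimensional measures near their endpoints -/

lemma lintegral_Ioo_one_sub_rpow {k s : ℝ} (hk : 0 < k) (hs : 0 ≤ s) :
    ∫⁻ t in Ioo (1 - s) 1, ENNReal.ofReal ((1 - t) ^ (k - 1)) = ENNReal.ofReal (s ^ k / k) := by
  have hint : IntervalIntegrable (fun t : ℝ => (1 - t) ^ (k - 1)) volume (1 - s) 1 := by
    have := (intervalIntegral.intervalIntegrable_rpow' (a := s) (b := 0)
      (by linarith : -1 < k - 1)).comp_sub_left 1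
    simpa using this
  have hval : ∫ t in (1 - s)..1, (1 - t) ^ (k - 1) = s ^ k / k := by
    rw [intervalIntegral.integral_comp_sub_left (fun t => t ^ (k - 1)) 1,
      integral_rpow (Or.inl (by linarith))]
    simp [Real.zero_rpow hk.ne']
  have hle : 1 - s ≤ 1 := by linarith
  rw [← hval, intervalIntegral.integral_of_le hle,
    ofReal_integral_eq_lintegral_ofReal
      ((intervalIntegrable_iff_integrableOn_Ioc_of_le hle).1 hint),
    restrict_Ioo_eq_restrict_Ioc]
  refine (ae_restrict_mem measurableSet_Ioc).mono fun t ht => ?_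
  exact Real.rpow_nonneg (by linarith [ht.2]) _

/-- Dropping the null endpoints makes `1 - t ^ 2` positive, so that it factors inside the real power
even when `k < 1`. -/
lemma jacobiMeasure_apply {k : ℝ} {s : Set ℝ} (hs : MeasurableSet s) :
    jacobiMeasure k s =
      ∫⁻ t in s ∩ Ioo (-1) 1, ENNReal.ofReal ((1 + t) * (1 - t ^ 2) ^ (k - 1)) := by
  rw [jacobiMeasure, withDensity_apply _ hs, Measure.restrict_restrict hs]
  refine setLIntegral_congr ?_
  exact (Filter.EventuallyEq.refl _ s).inter Ioo_ae_eq_Icc.symm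

lemma jacobi_density_le {k t : ℝ} (hk : 0 < k) (h0 : 0 ≤ t) (h1 : t < 1) :
    (1 - t ^ 2) ^ (k - 1) ≤ 2 ^ k * (1 - t) ^ (k - 1) := by
  rw [show 1 - t ^ 2 = (1 + t) * (1 - t) by ring,
    Real.mul_rpow (by linarith) (by linarith)]
  refine mul_le_mul_of_nonneg_right ?_ (Real.rpow_nonneg (by linarith) _)
  calc (1 + t) ^ (k - 1) ≤ (1 + t) ^ k :=
        Real.rpow_le_rpow_of_exponent_le (by linarith) (by linarith)
    _ ≤ 2 ^ k := Real.rpow_le_rpow (by linarith) (by linarith) hk.le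

lemma lintegral_Ioo_jacobi_le {k s : ℝ} (hk : 0 < k) (hs : 0 ≤ s) (hs1 : s ≤ 1) :
    ∫⁻ t in Ioo (1 - s) 1, ENNReal.ofReal (2 * (1 - t ^ 2) ^ (k - 1)) ≤
      ENNReal.ofReal (2 * 2 ^ k / k) * ENNReal.ofReal (s ^ k) := by
  have h2 : (0 : ℝ) ≤ 2 * 2 ^ k := by positivity
  calc _ ≤ ∫⁻ t in Ioo (1 - s) 1,
        ENNReal.ofReal (2 * 2 ^ k) * ENNReal.ofReal ((1 - t) ^ (k - 1)) := by
        refine setLIntegral_mono' measurableSet_Ioo fun t ht => ?_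
        rw [← ENNReal.ofReal_mul h2]
        refine ENNReal.ofReal_le_ofReal ?_
        rw [mul_assoc]
        have := jacobi_density_le hk (by linarith [ht.1]) ht.2
        linarith
    _ = _ := by
        rw [lintegral_const_mul' _ _ ENNReal.ofReal_ne_top, lintegral_Ioo_one_sub_rpow hk hs,
          ← ENNReal.ofReal_mul h2, ← ENNReal.ofReal_mul (by positivity)]
        congr 1; ring

/-- Once `1 + t` is replaced by `2` the density is even, so the end at `-1` costs no more than the
end at `1`. -/
lemma jacobiMeasure_one_sub_lt_abs_le_of_le_one {k s : ℝ} (hk : 0 < k) (hs : 0 ≤ s)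
    (hs1 : s ≤ 1) :
    jacobiMeasure k {t | 1 - s < |t|} ≤
      2 * (ENNReal.ofReal (2 * 2 ^ k / k) * ENNReal.ofReal (s ^ k)) := by
  have hm : MeasurableSet {t : ℝ | 1 - s < |t|} :=
    measurableSet_lt measurable_const (measurable_id.abs)
  set g : ℝ → ℝ≥0∞ := fun t => ENNReal.ofReal (2 * (1 - t ^ 2) ^ (k - 1)) with hg
  have hneg : ∫⁻ t in Ioo (-1) (-(1 - s)), g t = ∫⁻ t in Ioo (1 - s) 1, g t := by
    have : (fun t => -t) ⁻¹' Ioo (1 - s) 1 = Ioo (-1) (-(1 - s)) := by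
      ext t; simp only [mem_preimage, mem_Ioo]; constructor <;> rintro ⟨h, h'⟩ <;>
        constructor <;> linarith
    rw [← this,
      ← (Measure.measurePreserving_neg (volume : Measure ℝ)).setLIntegral_comp_preimage_emb
      (MeasurableEquiv.neg ℝ).measurableEmbedding g]
    simp [hg]
  calc jacobiMeasure k {t | 1 - s < |t|}
      = _ := jacobiMeasure_apply hm
    _ ≤ ∫⁻ t in {t | 1 - s < |t|} ∩ Ioo (-1) 1, g t := by
        refine setLIntegral_mono' (hm.inter measurableSet_Ioo) fun t ht => ?_
        refine ENNReal.ofReal_le_ofReal (mul_le_mul_of_nonneg_right (by linarith [ht.2.2]) ?_)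
        exact Real.rpow_nonneg (by nlinarith [ht.2.1, ht.2.2]) _
    _ ≤ ∫⁻ t in Ioo (1 - s) 1 ∪ Ioo (-1) (-(1 - s)), g t := by
        refine lintegral_mono_set ?_
        rintro t ⟨ht, h1, h2⟩
        rcases lt_abs.1 (show 1 - s < |t| from ht) with h | h
        · exact Or.inl ⟨h, h2⟩
        · exact Or.inr ⟨h1, by linarith⟩
    _ ≤ _ := lintegral_union_le _ _ _
    _ = 2 * ∫⁻ t in Ioo (1 - s) 1, g t := by rw [hneg, two_mul]
    _ ≤ _ := by gcongr; exact lintegral_Ioo_jacobi_le hk hs hs1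

lemma jacobiMeasure_compl_Ioo (k : ℝ) : jacobiMeasure k (Ioo (-1) 1)ᶜ = 0 := by
  rw [jacobiMeasure_apply measurableSet_Ioo.compl]; simp

lemma jacobiMeasure_univ_le {k : ℝ} (hk : 0 < k) :
    jacobiMeasure k univ ≤ 2 * ENNReal.ofReal (2 * 2 ^ k / k) := by
  have h0 : jacobiMeasure k ({0} : Set ℝ) = 0 := by
    rw [jacobiMeasure_apply (measurableSet_singleton _)]
    exact setLIntegral_measure_zero _ _ (measure_mono_null inter_subset_left (by simp))
  have := jacobiMeasure_one_sub_lt_abs_le_of_le_one hk zero_le_one le_rfl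
  calc jacobiMeasure k univ ≤ jacobiMeasure k ({0} ∪ {t | 1 - 1 < |t|}) := by
        refine measure_mono fun t _ => ?_
        rcases eq_or_ne t 0 with h | h
        · exact Or.inl h
        · exact Or.inr (by simpa using h)
    _ ≤ _ := measure_union_le _ _
    _ ≤ _ := by rw [h0, zero_add]; simpa using this

lemma jacobiMeasure_one_sub_lt_abs_le {k : ℝ} (hk : 0 < k) : ∃ C : ℝ≥0, ∀ s : ℝ, 0 < s →
    jacobiMeasure k {t | 1 - s < |t|} ≤ C * ENNReal.ofReal (s ^ k) := by
  refine ⟨(2 * ENNReal.ofReal (2 * 2 ^ k / k)).toNNReal, fun s hs => ?_⟩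
  rw [ENNReal.coe_toNNReal (by finiteness)]
  rcases le_total s 1 with h | h
  · rw [mul_assoc]; exact jacobiMeasure_one_sub_lt_abs_le_of_le_one hk hs.le h
  · calc _ ≤ _ := measure_mono (subset_univ _)
      _ ≤ _ := jacobiMeasure_univ_le hk
      _ ≤ _ := le_mul_of_one_le_right' (ENNReal.one_le_ofReal.2 (Real.one_le_rpow h hk.le))

lemma le_jacobiMeasure_Icc {k s : ℝ} (hk : 0 < k) (hs : 0 ≤ s) (hs1 : s ≤ 1) :
    ENNReal.ofReal (s ^ k / k) ≤ jacobiMeasure k (Icc (1 - s) 1) := by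
  rw [jacobiMeasure_apply measurableSet_Icc, ← lintegral_Ioo_one_sub_rpow hk hs]
  calc _ ≤ ∫⁻ t in Ioo (1 - s) 1, ENNReal.ofReal ((1 + t) * (1 - t ^ 2) ^ (k - 1)) := by
        refine setLIntegral_mono' measurableSet_Ioo fun t ht => ENNReal.ofReal_le_ofReal ?_
        have h1 : 0 ≤ 1 - t := by linarith [ht.2]
        have h2 : 1 ≤ 1 + t := by linarith [ht.1]
        rw [show 1 - t ^ 2 = (1 + t) * (1 - t) by ring, Real.mul_rpow (by linarith) h1,
          ← mul_assoc]
        refine le_mul_of_one_le_left (Real.rpow_nonneg h1 _) ?_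
        calc (1 : ℝ) ≤ (1 + t) ^ k := Real.one_le_rpow h2 hk.le
          _ = (1 + t) * (1 + t) ^ (k - 1) := by
            rw [Real.rpow_sub_one (by linarith)]; field_simp
    _ ≤ _ := by
        refine lintegral_mono_set fun t ht => ⟨⟨ht.1.le, ht.2.le⟩, ?_, ht.2⟩
        linarith [ht.1]

lemma jacobiMeasure_univ_ne_zero {k : ℝ} (hk : 0 < k) : jacobiMeasure k univ ≠ 0 := by
  have h := (le_jacobiMeasure_Icc hk zero_le_one le_rfl).trans (measure_mono (subset_univ _))
  refine (lt_of_lt_of_le ?_ h).ne'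
  simpa using hk

lemma jacobiMeasure_univ_ne_top {k : ℝ} (hk : 0 < k) : jacobiMeasure k univ ≠ ∞ :=
  ((jacobiMeasure_univ_le hk).trans_lt (by finiteness)).ne

lemma isProbabilityMeasure_intertwiningFactor {k : ℝ} (hk : 0 ≤ k) :
    IsProbabilityMeasure (intertwiningFactor k) := by
  rcases hk.eq_or_lt with rfl | hk
  · simp only [intertwiningFactor, if_true]; infer_instance
  · constructor
    rw [intertwiningFactor, if_neg hk.ne', Measure.smul_apply, smul_eq_mul,
      ENNReal.inv_mul_cancel (jacobiMeasure_univ_ne_zero hk) (jacobiMeasure_univ_ne_top hk)]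

lemma intertwiningFactor_ae_abs_le_one {k : ℝ} (hk : 0 ≤ k) :
    ∀ᵐ t ∂intertwiningFactor k, |t| ≤ 1 := by
  rcases hk.eq_or_lt with rfl | hk
  · simp [intertwiningFactor]
  · rw [intertwiningFactor, if_neg hk.ne']
    refine Measure.ae_smul_measure ?_ _
    refine measure_mono_null (fun t ht => ?_) (jacobiMeasure_compl_Ioo k)
    intro h
    exact ht (abs_le.2 ⟨h.1.le, h.2.le⟩)

/-- For `k = 0` the bound is total mass one against `s ^ 0 = 1`. Values `s > 1` are allowed because
the bound is applied at ten times a scale. -/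
lemma intertwiningFactor_one_sub_lt_abs_le {k : ℝ} (hk : 0 ≤ k) : ∃ C : ℝ≥0, ∀ s : ℝ, 0 < s →
    intertwiningFactor k {t | 1 - s < |t|} ≤ C * ENNReal.ofReal (s ^ k) := by
  have := isProbabilityMeasure_intertwiningFactor hk
  rcases hk.eq_or_lt with rfl | hk
  · exact ⟨1, fun s _ => by simpa using prob_le_one⟩
  · obtain ⟨C, hC⟩ := jacobiMeasure_one_sub_lt_abs_le hk
    refine ⟨(jacobiMeasure k univ)⁻¹.toNNReal * C, fun s hs => ?_⟩
    rw [intertwiningFactor, if_neg hk.ne', Measure.smul_apply, smul_eq_mul, ENNReal.coe_mul,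
      ENNReal.coe_toNNReal (ENNReal.inv_ne_top.2 (jacobiMeasure_univ_ne_zero hk)), mul_assoc]
    gcongr
    exact hC s hs

lemma le_intertwiningFactor_Icc {k : ℝ} (hk : 0 ≤ k) : ∃ C : ℝ≥0, ∀ s : ℝ, 0 < s → s ≤ 1 →
    ENNReal.ofReal (s ^ k) ≤ C * intertwiningFactor k (Icc (1 - s) 1) := by
  rcases hk.eq_or_lt with rfl | hk
  · refine ⟨1, fun s hs _ => ?_⟩
    simp [intertwiningFactor, hs.le]
  · have h0 := jacobiMeasure_univ_ne_zero hk
    have h1 := jacobiMeasure_univ_ne_top hk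
    refine ⟨(ENNReal.ofReal k * jacobiMeasure k univ).toNNReal, fun s hs hs1 => ?_⟩
    rw [ENNReal.coe_toNNReal (by finiteness), intertwiningFactor, if_neg hk.ne',
      Measure.smul_apply, smul_eq_mul, mul_assoc, ← mul_assoc (jacobiMeasure k univ),
      ENNReal.mul_inv_cancel h0 h1, one_mul]
    calc ENNReal.ofReal (s ^ k) = ENNReal.ofReal k * ENNReal.ofReal (s ^ k / k) := by
          rw [← ENNReal.ofReal_mul hk.le, mul_div_cancel₀ _ hk.ne']
      _ ≤ _ := by gcongr; exact le_jacobiMeasure_Icc hk hs.le hs1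

/-! ### Weighted measure of balls and doubling -/

lemma abs_coord_sub_le (x y : Sph d) (i : Fin (d + 1)) :
    |y.1 i - x.1 i| ≤ dist y x := by
  rw [Subtype.dist_eq, dist_eq_norm, ← Real.norm_eq_abs]
  exact PiLp.norm_apply_le (y.1 - x.1) i

lemma weightedMeasure_closedBall_le (κ : Fin (d + 1) → ℝ) (hκ : ∀ i, 0 ≤ κ i) :
    ∃ C : ℝ≥0, ∀ x : Sph d, ∀ r : ℝ, 0 < r → weightedMeasure κ (Metric.closedBall x r) ≤
      C * (ENNReal.ofReal (r ^ d) * ENNReal.ofReal ((∏ i, (|x.1 i| + r) ^ κ i) ^ 2)) := by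
  obtain ⟨C, hC⟩ := surfaceMeasure_closedBall_le d
  refine ⟨C, fun x r hr => ?_⟩
  rw [weightedMeasure, withDensity_apply _ Metric.isClosed_closedBall.measurableSet]
  calc _ ≤ ∫⁻ _ in Metric.closedBall x r, ENNReal.ofReal ((∏ i, (|x.1 i| + r) ^ κ i) ^ 2)
        ∂surfaceMeasure d := by
        refine setLIntegral_mono' Metric.isClosed_closedBall.measurableSet fun y hy => ?_
        refine ENNReal.ofReal_le_ofReal ?_
        unfold weight
        gcongr with i
        · exact hκ i
        · have h1 := abs_coord_sub_le x y i
          have h2 := abs_sub_abs_le_abs_sub (y.1 i) (x.1 i)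
          have h3 : dist y x ≤ r := hy
          linarith
    _ = _ := setLIntegral_const _ _
    _ ≤ _ := by
      rw [mul_comm, ← mul_assoc]
      gcongr
      exact hC x r hr

/-- A point close to `x` whose coordinates are all bounded away from zero. -/
lemma exists_near_coord_ge (x : Sph d) {r : ℝ} (hr0 : 0 < r) (hr2 : r ≤ 2) :
    ∃ z : Sph d, dist z x ≤ r / 8 ∧
      ∀ i, (|x.1 i| + r / (16 * (d + 1))) / 2 ≤ |z.1 i| := by
  set δ : ℝ := r / (16 * (d + 1)) with hδ
  have hd : (0 : ℝ) < d + 1 := by positivity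
  have hδ0 : 0 < δ := by positivity
  -- Every coordinate is pushed away from zero by `δ`, then the point is normalized. The push has
  -- `ℓ¹` norm `r / 16` and normalizing costs at most `r / 16` more, whence `r / 8`.
  let σ : Fin (d + 1) → ℝ := fun i => if 0 ≤ x.1 i then 1 else -1
  have hσ : ∀ i, |σ i| = 1 := fun i => by by_cases h : 0 ≤ x.1 i <;> simp [σ, h]
  have hxσ : ∀ i, |x.1 i + δ * σ i| = |x.1 i| + δ := fun i => by
    by_cases h : 0 ≤ x.1 i
    · simp only [σ, h, if_true, mul_one, abs_of_nonneg h]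
      exact abs_of_nonneg (by linarith)
    · push Not at h
      simp only [σ, not_le.2 h, if_false, abs_of_neg h]
      rw [abs_of_neg (by linarith)]; ring
  let u : EuclideanSpace ℝ (Fin (d + 1)) := WithLp.toLp 2 fun i => δ * σ i
  have hu : ‖u‖ ≤ r / 16 := by
    calc ‖u‖ ≤ ∑ i, ‖u i‖ := by
          conv_lhs => rw [← (EuclideanSpace.basisFun (Fin (d + 1)) ℝ).sum_repr u]
          refine (norm_sum_le _ _).trans (Finset.sum_le_sum fun i _ => ?_)
          rw [norm_smul]; simp
      _ = r / 16 := by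
          simp only [u, Real.norm_eq_abs, abs_mul, hσ, abs_of_pos hδ0, mul_one, Finset.sum_const,
            Finset.card_univ, Fintype.card_fin, nsmul_eq_mul]
          rw [hδ]; push_cast; field_simp
  set w : EuclideanSpace ℝ (Fin (d + 1)) := x.1 + u with hw
  have hw1 : |‖w‖ - 1| ≤ r / 16 := by
    have := abs_norm_sub_norm_le w x.1
    rw [norm_coe_sphere, hw, add_sub_cancel_left] at this
    linarith
  have hw2 := abs_le.1 hw1
  have hw0 : 0 < ‖w‖ := by linarith
  let z : Sph d := ⟨‖w‖⁻¹ • w, by simp [norm_smul, hw0.ne']⟩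
  have hzw : w = ‖w‖ • z.1 := by simp [z, smul_smul, hw0.ne']
  refine ⟨z, ?_, fun i => ?_⟩
  · rw [Subtype.dist_eq, dist_eq_norm]
    have h1 : ‖z.1 - w‖ ≤ r / 16 := by
      rw [show z.1 - w = (1 - ‖w‖) • z.1 by rw [sub_smul, one_smul, ← hzw], norm_smul,
        norm_coe_sphere, Real.norm_eq_abs, mul_one, abs_sub_comm]
      exact hw1
    have h2 := norm_add_le (z.1 - w) (w - x.1)
    rw [sub_add_sub_cancel] at h2
    have h3 : w - x.1 = u := by rw [hw, add_sub_cancel_left]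
    rw [h3] at h2
    linarith
  · have hzi : |z.1 i| = ‖w‖⁻¹ * (|x.1 i| + δ) := by
      have h1 : z.1 i = ‖w‖⁻¹ * (x.1 i + δ * σ i) := rfl
      rw [h1, ← hxσ i, abs_mul, abs_of_pos (inv_pos.2 hw0)]
    rw [hzi, div_eq_inv_mul]
    gcongr
    linarith

lemma le_weightedMeasure_closedBall (κ : Fin (d + 1) → ℝ) (hκ : ∀ i, 0 ≤ κ i) :
    ∃ C : ℝ≥0, ∀ x : Sph d, ∀ r : ℝ, 0 < r → r ≤ 2 →
      ENNReal.ofReal (r ^ d) * ENNReal.ofReal ((∏ i, (|x.1 i| + r) ^ κ i) ^ 2) ≤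
        C * weightedMeasure κ (Metric.closedBall x (r / 2)) := by
  obtain ⟨C, hC⟩ := le_surfaceMeasure_closedBall d
  -- Chosen so that `4 * a * r` is the push of `exists_near_coord_ge`: on the ball of radius `a * r`
  -- about `z`, `|y i| ≥ (|x i| + 4 * a * r) / 2 - a * r ≥ a * (|x i| + r)`.
  set a : ℝ := (64 * (d + 1))⁻¹ with ha
  have ha0 : 0 < a := by positivity
  have ha64 : a ≤ 1 / 64 := by
    rw [ha, one_div]; gcongr; linarith [(Nat.cast_nonneg d : (0 : ℝ) ≤ d)]
  set p : ℝ := (∏ i, a ^ κ i) ^ 2 with hp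
  have hp0 : 0 < p := by positivity
  refine ⟨(ENNReal.ofReal ((a / 2) ^ d)⁻¹ * ENNReal.ofReal p⁻¹).toNNReal * C,
    fun x r hr0 hr2 => ?_⟩
  obtain ⟨z, hzx, hz⟩ := exists_near_coord_ge x hr0 hr2
  set W : ℝ := (∏ i, (|x.1 i| + r) ^ κ i) ^ 2 with hW
  have hmeas : MeasurableSet (Metric.closedBall z (2 * (a / 2 * r))) :=
    Metric.isClosed_closedBall.measurableSet
  have hsub : Metric.closedBall z (2 * (a / 2 * r)) ⊆ Metric.closedBall x (r / 2) := by
    refine Metric.closedBall_subset_closedBall' ?_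
    nlinarith
  have hlow : ENNReal.ofReal (p * W) * surfaceMeasure d (Metric.closedBall z (2 * (a / 2 * r))) ≤
      weightedMeasure κ (Metric.closedBall x (r / 2)) := by
    refine le_trans ?_ (measure_mono hsub)
    rw [weightedMeasure, withDensity_apply _ hmeas, ← setLIntegral_const]
    refine setLIntegral_mono' hmeas fun y hy => ENNReal.ofReal_le_ofReal ?_
    rw [hp, hW, ← mul_pow, ← Finset.prod_mul_distrib]
    unfold weight
    gcongr with i
    · rw [← Real.mul_rpow ha0.le (by positivity)]
      refine Real.rpow_le_rpow (by positivity) ?_ (hκ i)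
      have h1 := abs_coord_sub_le z y i
      have h2 := abs_sub_abs_le_abs_sub (z.1 i) (y.1 i)
      rw [abs_sub_comm] at h2
      have h3 : dist y z ≤ 2 * (a / 2 * r) := hy
      have h4 := hz i
      have h5 : r / (16 * (d + 1)) = 4 * a * r := by rw [ha]; field_simp; norm_num
      rw [h5] at h4
      nlinarith [abs_nonneg (x.1 i), mul_pos ha0 hr0]
  have hsurf := hC z (a / 2 * r) (by positivity) (by nlinarith)
  rw [mul_pow, ENNReal.ofReal_mul (by positivity)] at hsurf
  rw [ENNReal.coe_mul, ENNReal.coe_toNNReal (by finiteness)]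
  have e1 : ENNReal.ofReal (r ^ d) = ENNReal.ofReal ((a / 2) ^ d)⁻¹ *
      (ENNReal.ofReal ((a / 2) ^ d) * ENNReal.ofReal (r ^ d)) := by
    rw [← mul_assoc, ← ENNReal.ofReal_mul (by positivity), inv_mul_cancel₀ (by positivity)]
    simp
  have e2 : ENNReal.ofReal W = ENNReal.ofReal p⁻¹ * ENNReal.ofReal (p * W) := by
    rw [← ENNReal.ofReal_mul (by positivity), inv_mul_cancel_left₀ hp0.ne']
  calc ENNReal.ofReal (r ^ d) * ENNReal.ofReal W
      ≤ ENNReal.ofReal ((a / 2) ^ d)⁻¹ *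
          (C * surfaceMeasure d (Metric.closedBall z (2 * (a / 2 * r)))) *
          (ENNReal.ofReal p⁻¹ * ENNReal.ofReal (p * W)) := by
        rw [← e2, e1]; gcongr
    _ = ENNReal.ofReal ((a / 2) ^ d)⁻¹ * ENNReal.ofReal p⁻¹ * C * (ENNReal.ofReal (p * W) *
          surfaceMeasure d (Metric.closedBall z (2 * (a / 2 * r)))) := by ring
    _ ≤ _ := by gcongr

/-- A doubling property of the weighted measure, uniform over the orbits of sign changes. -/
lemma weightedMeasure_closedBall_le_half (κ : Fin (d + 1) → ℝ) (hκ : ∀ i, 0 ≤ κ i) :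
    ∃ C : ℝ≥0, ∀ x x' : Sph d, (∀ i, |x'.1 i| = |x.1 i|) → ∀ r : ℝ, 0 < r → r ≤ 2 →
      weightedMeasure κ (Metric.closedBall x' r) ≤
        C * weightedMeasure κ (Metric.closedBall x (r / 2)) := by
  obtain ⟨C, hC⟩ := weightedMeasure_closedBall_le κ hκ
  obtain ⟨C', hC'⟩ := le_weightedMeasure_closedBall κ hκ
  refine ⟨C * C', fun x x' h r hr0 hr2 => (hC x' r hr0).trans ?_⟩
  simp only [h]
  rw [ENNReal.coe_mul, mul_assoc]
  exact mul_le_mul_right (hC' x r hr0 hr2) _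

/-! ### Caps, chords and sign changes -/

lemma inner_eq_sum (x y : EuclideanSpace ℝ (Fin (d + 1))) : inner ℝ x y = ∑ i, x i * y i := by
  simp [PiLp.inner_apply, mul_comm]

lemma dist_le_iff_inner (x y : Sph d) {r : ℝ} (hr : 0 ≤ r) :
    dist y x ≤ r ↔ 1 - r ^ 2 / 2 ≤ inner ℝ x.1 y.1 := by
  have h := norm_sub_sq_real x.1 y.1
  rw [norm_coe_sphere, norm_coe_sphere] at h
  rw [Subtype.dist_eq, dist_comm, dist_eq_norm, ← sq_le_sq₀ (norm_nonneg _) hr, h]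
  constructor <;> intro <;> linarith

lemma cos_eq_one_sub_sq (θ : ℝ) : Real.cos θ = 1 - (2 * Real.sin (θ / 2)) ^ 2 / 2 := by
  have h1 := Real.cos_two_mul (θ / 2)
  rw [mul_div_cancel₀ _ two_ne_zero] at h1
  have h2 := Real.sin_sq_add_cos_sq (θ / 2)
  rw [h1]; linarith

lemma cap_eq_closedBall (x : Sph d) {θ : ℝ} (h0 : 0 ≤ θ) (h1 : θ ≤ Real.pi) :
    cap x θ = Metric.closedBall x (2 * Real.sin (θ / 2)) := by
  have hs : 0 ≤ 2 * Real.sin (θ / 2) :=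
    mul_nonneg zero_le_two (Real.sin_nonneg_of_nonneg_of_le_pi (by linarith) (by linarith))
  ext y
  rw [Metric.mem_closedBall, dist_le_iff_inner x y hs, ← cos_eq_one_sub_sq]
  rfl

lemma sum_abs_mul_abs_le_one (x y : Sph d) : ∑ i, |x.1 i| * |y.1 i| ≤ 1 := by
  have hx : ∑ i, |x.1 i| ^ 2 = 1 := by
    have h := EuclideanSpace.norm_sq_eq x.1
    rw [norm_coe_sphere] at h; simpa using h.symm
  have hy : ∑ i, |y.1 i| ^ 2 = 1 := by
    have h := EuclideanSpace.norm_sq_eq y.1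
    rw [norm_coe_sphere] at h; simpa using h.symm
  have h : ∑ i, |x.1 i| * |y.1 i| ≤ ∑ i, (|x.1 i| ^ 2 + |y.1 i| ^ 2) / 2 :=
    Finset.sum_le_sum fun i _ => by nlinarith [sq_nonneg (|x.1 i| - |y.1 i|)]
  rw [← Finset.sum_div, Finset.sum_add_distrib, hx, hy] at h
  linarith

lemma abs_signChange (x : Sph d) (ε : Fin (d + 1) → ℤˣ) (i : Fin (d + 1)) :
    |(signChange x ε).1 i| = |x.1 i| := by
  rcases Int.units_eq_one_or (ε i) with h | h <;> simp [signChange, h]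

lemma exists_dist_signChange_le (x y : Sph d) {r : ℝ} (hr : 0 ≤ r)
    (h : 1 - r ^ 2 / 2 ≤ ∑ i, |x.1 i| * |y.1 i|) :
    ∃ ε : Fin (d + 1) → ℤˣ, dist y (signChange x ε) ≤ r := by
  refine ⟨fun i => if 0 ≤ x.1 i * y.1 i then 1 else -1, ?_⟩
  rw [dist_le_iff_inner _ _ hr, inner_eq_sum]
  refine h.trans (Finset.sum_le_sum fun i _ => ?_)
  rw [← abs_mul]
  by_cases h' : 0 ≤ x.1 i * y.1 i
  · simp [signChange, h', abs_of_nonneg h']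
  · simp [signChange, h', abs_of_neg (not_le.1 h')]

/-! ### Two-sided bounds for the kernel -/

/-- The squared relative size of the radius `r` at the `i`-th coordinate of `x`. -/
def scale (x : Sph d) (r : ℝ) (i : Fin (d + 1)) : ℝ := (r / (|x.1 i| + r)) ^ 2

lemma scale_pos (x : Sph d) {r : ℝ} (hr : 0 < r) (i : Fin (d + 1)) : 0 < scale x r i := by
  unfold scale; positivity

lemma scale_le_one (x : Sph d) {r : ℝ} (hr : 0 < r) (i : Fin (d + 1)) : scale x r i ≤ 1 := by
  unfold scale
  refine pow_le_one₀ (by positivity) ((div_le_one (by positivity)).2 ?_)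
  linarith [abs_nonneg (x.1 i)]

lemma sum_mul_le_sum_abs {x y : Sph d} {t : Fin (d + 1) → ℝ} (ht : ∀ i, |t i| ≤ 1) :
    ∑ i, x.1 i * (y.1 i * t i) ≤ ∑ i, |x.1 i| * |y.1 i| := by
  refine Finset.sum_le_sum fun i _ => (le_abs_self _).trans ?_
  rw [abs_mul, abs_mul, ← mul_assoc]
  exact mul_le_of_le_one_right (by positivity) (ht i)

/-- As `∑ |x i| * |y i| ≤ 1`, each loss `|x j| * |y j| * (1 - |t j|)` is at most `r ^ 2 / 2`. If `|x
j| ≥ 2 * r`, then `|y j| ≥ |x j| / 2`, so the loss bounds `1 - |t j|`. Otherwise the scale exceeds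
`1 / 9`, and the factor `10` makes the claim trivial. -/
lemma one_sub_scale_lt_abs {x y : Sph d} {r : ℝ} (hr : 0 < r) {t : Fin (d + 1) → ℝ}
    (ht : ∀ i, |t i| ≤ 1) (h : 1 - r ^ 2 / 2 ≤ ∑ i, x.1 i * (y.1 i * t i)) (j : Fin (d + 1)) :
    1 - 10 * scale x r j < |t j| := by
  obtain ⟨ε, hε⟩ := exists_dist_signChange_le x y hr.le (h.trans (sum_mul_le_sum_abs ht))
  have hy : |x.1 j| - r ≤ |y.1 j| := by
    have h1 := abs_coord_sub_le (signChange x ε) y j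
    have h2 := abs_sub_abs_le_abs_sub ((signChange x ε).1 j) (y.1 j)
    rw [abs_sub_comm, abs_signChange] at h2
    linarith
  have hj : |x.1 j| * |y.1 j| * (1 - |t j|) ≤ r ^ 2 / 2 := by
    have h1 : |x.1 j| * |y.1 j| * (1 - |t j|) ≤ ∑ i, |x.1 i| * |y.1 i| * (1 - |t i|) :=
      Finset.single_le_sum (f := fun i => |x.1 i| * |y.1 i| * (1 - |t i|))
        (fun i _ => mul_nonneg (by positivity) (sub_nonneg.2 (ht i))) (Finset.mem_univ j)
    have h2 : ∑ i, x.1 i * (y.1 i * t i) ≤ ∑ i, |x.1 i| * |y.1 i| * |t i| :=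
      Finset.sum_le_sum fun i _ => by
        rw [← abs_mul, ← abs_mul, mul_assoc]; exact le_abs_self _
    have h3 := sum_abs_mul_abs_le_one x y
    simp only [mul_sub, mul_one, Finset.sum_sub_distrib] at h1
    linarith
  have hw1 : 0 ≤ 1 - |t j| := sub_nonneg.2 (ht j)
  have hw2 : 1 - |t j| ≤ 1 := by linarith [abs_nonneg (t j)]
  set w := 1 - |t j|
  have hu := abs_nonneg (x.1 j)
  have hv := abs_nonneg (y.1 j)
  generalize |y.1 j| = v at *
  have hs : scale x r j = r ^ 2 / (|x.1 j| + r) ^ 2 := div_pow _ _ _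
  generalize |x.1 j| = u at *
  suffices w < 10 * scale x r j by simp only [w] at this; linarith
  rw [hs, ← mul_div_assoc, lt_div_iff₀ (by positivity)]
  rcases lt_or_ge u (2 * r) with h2 | h2
  · calc w * (u + r) ^ 2 ≤ 1 * (3 * r) ^ 2 := by gcongr; linarith
      _ < 10 * r ^ 2 := by nlinarith [pow_pos hr 2]
  · have h3 : u / 2 ≤ v := by linarith
    have h4 : u * (u / 2) * w ≤ r ^ 2 / 2 := le_trans (by gcongr) hj
    calc w * (u + r) ^ 2 ≤ w * (3 / 2 * u) ^ 2 := by gcongr; linarith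
      _ < 10 * r ^ 2 := by nlinarith [pow_pos hr 2]

variable {κ : Fin (d + 1) → ℝ}

/-- The set of the parameters for which the dilated point lies in the solid cap. -/
def capParameters (x : Sph d) (θ : ℝ) (y : Sph d) : Set (Fin (d + 1) → ℝ) :=
  {t | WithLp.toLp 2 (fun i => y.1 i * t i) ∈ solidCap x θ}

lemma measurableSet_capParameters (x : Sph d) (θ : ℝ) (y : Sph d) :
    MeasurableSet (capParameters x θ y) := by
  have h : Continuous fun t : Fin (d + 1) → ℝ =>
      (WithLp.toLp 2 (fun i => y.1 i * t i) : EuclideanSpace ℝ (Fin (d + 1))) := by fun_prop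
  have hin : Continuous fun y : EuclideanSpace ℝ (Fin (d + 1)) => inner ℝ x.1 y :=
    continuous_const.inner continuous_id
  have hc : IsClosed (solidCap x θ) := by
    rw [solidCap, ofPred_and]
    exact (isClosed_le continuous_norm continuous_const).inter (isClosed_le continuous_const hin)
  exact (hc.preimage h).measurableSet

lemma capKernel_eq (hκ : ∀ i, 0 ≤ κ i) (x : Sph d) (θ : ℝ) (y : Sph d) :
    capKernel κ x θ y =
      Measure.pi (fun i => intertwiningFactor (κ i)) (capParameters x θ y) := by
  have := fun i => isProbabilityMeasure_intertwiningFactor (hκ i)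
  have h : (fun t : Fin (d + 1) → ℝ => (solidCap x θ).indicator (fun _ => (1 : ℝ))
      (WithLp.toLp 2 fun i => y.1 i * t i)) = (capParameters x θ y).indicator 1 := by
    ext t; simp only [indicator, capParameters]; rfl
  rw [capKernel, intertwining, h, integral_indicator_one (measurableSet_capParameters x θ y),
    ofReal_measureReal]

lemma ae_pi_abs_le_one (hκ : ∀ i, 0 ≤ κ i) :
    ∀ᵐ t ∂Measure.pi (fun i => intertwiningFactor (κ i)), ∀ i, |t i| ≤ 1 := by
  have := fun i => isProbabilityMeasure_intertwiningFactor (hκ i)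
  exact ae_all_iff.2 fun i =>
    (Measure.tendsto_eval_ae_ae (μ := fun i => intertwiningFactor (κ i))).eventually
      (intertwiningFactor_ae_abs_le_one (hκ i))

lemma le_sum_of_mem_capParameters {x y : Sph d} {θ r : ℝ} (hθ : Real.cos θ = 1 - r ^ 2 / 2)
    {t : Fin (d + 1) → ℝ} (ht : t ∈ capParameters x θ y) :
    1 - r ^ 2 / 2 ≤ ∑ i, x.1 i * (y.1 i * t i) := by
  have h : Real.cos θ ≤ inner ℝ x.1 (WithLp.toLp 2 fun i => y.1 i * t i) := ht.2
  rw [inner_eq_sum, hθ] at h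
  exact h

lemma capKernel_le (hκ : ∀ i, 0 ≤ κ i) : ∃ C : ℝ≥0, ∀ (x y : Sph d) (θ r : ℝ), 0 < r →
    Real.cos θ = 1 - r ^ 2 / 2 →
      capKernel κ x θ y ≤ C * ∏ i, ENNReal.ofReal (scale x r i ^ κ i) := by
  have := fun i => isProbabilityMeasure_intertwiningFactor (hκ i)
  choose C hC using fun i => intertwiningFactor_one_sub_lt_abs_le (hκ i)
  refine ⟨∏ i, C i * (ENNReal.ofReal (10 ^ κ i)).toNNReal, fun x y θ r hr hθ => ?_⟩
  calc capKernel κ x θ y = _ := capKernel_eq hκ x θ y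
    _ ≤ Measure.pi (fun i => intertwiningFactor (κ i))
        (univ.pi fun i => {t | 1 - 10 * scale x r i < |t|}) := by
        refine measure_mono_ae ?_
        filter_upwards [ae_pi_abs_le_one hκ] with t ht htc i _
        exact one_sub_scale_lt_abs hr ht (le_sum_of_mem_capParameters hθ htc) i
    _ = ∏ i, intertwiningFactor (κ i) {t | 1 - 10 * scale x r i < |t|} := Measure.pi_pi _ _
    _ ≤ ∏ i, (C i * (ENNReal.ofReal (10 ^ κ i)).toNNReal : ℝ≥0) *
          ENNReal.ofReal (scale x r i ^ κ i) := by
        refine Finset.prod_le_prod' fun i _ => ?_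
        refine (hC i _ (mul_pos (by norm_num) (scale_pos x hr i))).trans_eq ?_
        rw [Real.mul_rpow (by norm_num) (scale_pos x hr i).le, ENNReal.ofReal_mul (by positivity),
          ENNReal.coe_mul, ENNReal.coe_toNNReal ENNReal.ofReal_ne_top, mul_assoc]
    _ = _ := by rw [Finset.prod_mul_distrib, ENNReal.ofNNReal_finsetProd]

lemma exists_dist_signChange_le_of_capKernel_ne_zero (hκ : ∀ i, 0 ≤ κ i) {x y : Sph d} {θ r : ℝ}
    (hr : 0 < r) (hθ : Real.cos θ = 1 - r ^ 2 / 2) (h : capKernel κ x θ y ≠ 0) :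
    ∃ ε : Fin (d + 1) → ℤˣ, dist y (signChange x ε) ≤ r := by
  by_contra hne
  refine h ?_
  rw [capKernel_eq hκ, measure_eq_zero_iff_ae_notMem]
  filter_upwards [ae_pi_abs_le_one hκ] with t ht htc
  exact hne (exists_dist_signChange_le x y hr.le
    ((le_sum_of_mem_capParameters hθ htc).trans (sum_mul_le_sum_abs ht)))

/-- From `dist y x ≤ r / 2` the inner product is at least `1 - r ^ 2 / 8`, which leaves a slack of
`3 / 8 * r ^ 2`. Shared equally among the `d + 1` coordinates, it gives the constant of the box. -/
lemma pi_Icc_subset_capParameters {x y : Sph d} {θ r : ℝ} (hr : 0 < r)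
    (hθ : Real.cos θ = 1 - r ^ 2 / 2) (hy : dist y x ≤ r / 2) :
    (univ.pi fun i => Icc (1 - 3 / (8 * (d + 1)) * scale x r i) 1) ⊆ capParameters x θ y := by
  intro t ht
  have ha : 3 / (8 * ((d : ℝ) + 1)) ≤ 1 := by
    rw [div_le_one (by positivity)]; linarith [(Nat.cast_nonneg d : (0 : ℝ) ≤ d)]
  have ht0 : ∀ i, 0 ≤ t i ∧ t i ≤ 1 := fun i => by
    have h1 := (ht i (mem_univ i)).1
    refine ⟨?_, (ht i (mem_univ i)).2⟩
    have h2 := scale_le_one x hr i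
    have h3 := (scale_pos x hr i).le
    nlinarith
  constructor
  · refine le_of_le_of_eq ?_ (norm_coe_sphere y)
    rw [EuclideanSpace.norm_eq, EuclideanSpace.norm_eq]
    refine Real.sqrt_le_sqrt (Finset.sum_le_sum fun i _ => ?_)
    simp only [Real.norm_eq_abs, abs_mul, abs_of_nonneg (ht0 i).1]
    refine pow_le_pow_left₀ (mul_nonneg (abs_nonneg _) (ht0 i).1) ?_ 2
    exact mul_le_of_le_one_right (abs_nonneg _) (ht0 i).2
  · rw [inner_eq_sum, hθ]
    have hin := (dist_le_iff_inner x y (by positivity)).1 hy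
    rw [inner_eq_sum] at hin
    have hterm : ∀ i, x.1 i * y.1 i * (1 - t i) ≤ 3 / (8 * (d + 1)) * r ^ 2 := fun i => by
      have h1 := abs_coord_sub_le x y i
      have h2 := abs_sub_abs_le_abs_sub (y.1 i) (x.1 i)
      have hu := abs_nonneg (x.1 i)
      have hyi : |y.1 i| ≤ |x.1 i| + r := by linarith
      have h3 : x.1 i * y.1 i ≤ (|x.1 i| + r) ^ 2 := by
        calc x.1 i * y.1 i ≤ |x.1 i| * |y.1 i| := by rw [← abs_mul]; exact le_abs_self _
          _ ≤ (|x.1 i| + r) * (|x.1 i| + r) := by gcongr; linarith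
          _ = _ := (sq _).symm
      calc x.1 i * y.1 i * (1 - t i) ≤ (|x.1 i| + r) ^ 2 * (1 - t i) :=
            mul_le_mul_of_nonneg_right h3 (by linarith [(ht0 i).2])
        _ ≤ (|x.1 i| + r) ^ 2 * (3 / (8 * (d + 1)) * scale x r i) := by
            have := (ht i (mem_univ i)).1
            gcongr; linarith
        _ = 3 / (8 * (d + 1)) * r ^ 2 := by unfold scale; field_simp
    have hsum := Finset.sum_le_sum fun i (_ : i ∈ Finset.univ) => hterm i
    simp only [Finset.sum_const, Finset.card_univ, Fintype.card_fin, nsmul_eq_mul, mul_sub, mul_one,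
      Finset.sum_sub_distrib] at hsum
    have e : ((d + 1 : ℕ) : ℝ) * (3 / (8 * (d + 1)) * r ^ 2) = 3 / 8 * r ^ 2 := by
      push_cast; field_simp
    rw [e] at hsum
    simp only [mul_assoc] at hsum
    simp only
    nlinarith

lemma le_capKernel (hκ : ∀ i, 0 ≤ κ i) : ∃ C : ℝ≥0, ∀ (x y : Sph d) (θ r : ℝ), 0 < r →
    Real.cos θ = 1 - r ^ 2 / 2 → dist y x ≤ r / 2 →
      ∏ i, ENNReal.ofReal (scale x r i ^ κ i) ≤ C * capKernel κ x θ y := by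
  have := fun i => isProbabilityMeasure_intertwiningFactor (hκ i)
  choose C hC using fun i => le_intertwiningFactor_Icc (hκ i)
  set a : ℝ := 3 / (8 * (d + 1)) with ha
  have ha0 : 0 < a := by positivity
  have ha1 : a ≤ 1 := by
    rw [ha, div_le_one (by positivity)]; linarith [(Nat.cast_nonneg d : (0 : ℝ) ≤ d)]
  refine ⟨∏ i, (ENNReal.ofReal (a ^ κ i)⁻¹).toNNReal * C i, fun x y θ r hr hθ hy => ?_⟩
  calc ∏ i, ENNReal.ofReal (scale x r i ^ κ i)
      ≤ ∏ i, ((ENNReal.ofReal (a ^ κ i)⁻¹).toNNReal * C i : ℝ≥0) *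
          intertwiningFactor (κ i) (Icc (1 - a * scale x r i) 1) := by
        refine Finset.prod_le_prod' fun i _ => ?_
        have hs := scale_pos x hr i
        have hai : (0 : ℝ) < a ^ κ i := by positivity
        have h := hC i (a * scale x r i) (by positivity)
          (mul_le_one₀ ha1 hs.le (scale_le_one x hr i))
        rw [ENNReal.coe_mul, ENNReal.coe_toNNReal ENNReal.ofReal_ne_top, mul_assoc]
        calc ENNReal.ofReal (scale x r i ^ κ i)
            = ENNReal.ofReal (a ^ κ i)⁻¹ * ENNReal.ofReal ((a * scale x r i) ^ κ i) := by
              rw [Real.mul_rpow ha0.le hs.le, ← ENNReal.ofReal_mul (by positivity),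
                inv_mul_cancel_left₀ hai.ne']
          _ ≤ _ := by gcongr
    _ = (∏ i, (ENNReal.ofReal (a ^ κ i)⁻¹).toNNReal * C i : ℝ≥0) *
          Measure.pi (fun i => intertwiningFactor (κ i))
            (univ.pi fun i => Icc (1 - a * scale x r i) 1) := by
        rw [Finset.prod_mul_distrib, ENNReal.ofNNReal_finsetProd, Measure.pi_pi]
    _ ≤ _ := by
        rw [capKernel_eq hκ]
        gcongr
        exact pi_Icc_subset_capParameters hr hθ hy

/-! ### Comparison of the maximal functions -/

lemma setLIntegral_cap_le {𝕜 : Type*} [RCLike 𝕜] (hκ : ∀ i, 0 ≤ κ i) (f : Sph d → 𝕜) (x : Sph d)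
    {θ : ℝ} (h0 : 0 < θ) (h1 : θ ≤ Real.pi) :
    ∫⁻ y in cap x θ, ‖f y‖ₑ ∂weightedMeasure κ ≤
      hlMaximal κ f x * weightedMeasure κ (cap x θ) := by
  have hle : (∫⁻ y in cap x θ, ‖f y‖ₑ ∂weightedMeasure κ) / weightedMeasure κ (cap x θ) ≤
      hlMaximal κ f x :=
    le_iSup₂ (f := fun θ (_ : θ ∈ Ioc (0 : ℝ) Real.pi) =>
      (∫⁻ y in cap x θ, ‖f y‖ₑ ∂weightedMeasure κ) / weightedMeasure κ (cap x θ)) θ ⟨h0, h1⟩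
  rcases eq_or_ne (weightedMeasure κ (cap x θ)) 0 with h | h
  · rw [setLIntegral_measure_zero _ _ h]; exact zero_le
  · have hfin : weightedMeasure κ (cap x θ) ≠ ∞ := by
      obtain ⟨C, hC⟩ := weightedMeasure_closedBall_le κ hκ
      rw [cap_eq_closedBall x h0.le h1]
      refine ((hC x _ ?_).trans_lt (by finiteness)).ne
      exact mul_pos two_pos (Real.sin_pos_of_pos_of_lt_pi (by linarith) (by linarith))
    exact (ENNReal.div_le_iff h hfin).1 hle

lemma intertwiningMaximal_le {𝕜 : Type*} [RCLike 𝕜] (hκ : ∀ i, 0 ≤ κ i) :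
    ∃ c : ℝ≥0, ∀ f : Sph d → 𝕜, Integrable f (weightedMeasure κ) → ∀ x : Sph d,
      intertwiningMaximal κ f x ≤
        c * ∑ ε : Fin (d + 1) → ℤˣ, hlMaximal κ f (signChange x ε) := by
  obtain ⟨C₁, hC₁⟩ := capKernel_le hκ
  obtain ⟨C₂, hC₂⟩ := le_capKernel hκ
  obtain ⟨C₃, hC₃⟩ := weightedMeasure_closedBall_le_half κ hκ
  refine ⟨C₁ * C₃ * C₂, fun f hf x => iSup₂_le fun θ hθ => ENNReal.div_le_of_le_mul ?_⟩
  set r : ℝ := 2 * Real.sin (θ / 2) with hr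
  have hcos : Real.cos θ = 1 - r ^ 2 / 2 := cos_eq_one_sub_sq θ
  have hr0 : 0 < r :=
    mul_pos two_pos (Real.sin_pos_of_pos_of_lt_pi (by linarith [hθ.1])
      (by linarith [hθ.1, hθ.2]))
  have hr2 : r ≤ 2 := by linarith [Real.sin_le_one (θ / 2)]
  set P := ∏ i, ENNReal.ofReal (scale x r i ^ κ i) with hP
  have hPtop : P ≠ ∞ := ENNReal.prod_ne_top fun i _ => ENNReal.ofReal_ne_top
  set D := ∫⁻ y, capKernel κ x θ y ∂weightedMeasure κ with hD
  set S := ∑ ε : Fin (d + 1) → ℤˣ, hlMaximal κ f (signChange x ε) with hS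
  have hmeas : ∀ z : Sph d, MeasurableSet (cap z θ) := fun z => by
    rw [cap_eq_closedBall z hθ.1.le hθ.2]; exact Metric.isClosed_closedBall.measurableSet
  -- The denominator is bounded below by integrating the kernel over the half ball only.
  have hlow : P * weightedMeasure κ (Metric.closedBall x (r / 2)) ≤ C₂ * D := by
    rw [hD, ← lintegral_const_mul' _ _ ENNReal.coe_ne_top, ← setLIntegral_const]
    refine (setLIntegral_mono' Metric.isClosed_closedBall.measurableSet fun y hy => ?_).trans
      (setLIntegral_le_lintegral _ _)
    exact hC₂ x y θ r hr0 hcos hy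
  calc ∫⁻ y, ‖f y‖ₑ * capKernel κ x θ y ∂weightedMeasure κ
      -- Where the kernel is nonzero, `y` lies in at least one of the reflected caps; overlaps only
      -- enlarge the sum.
      ≤ ∫⁻ y, ∑ ε : Fin (d + 1) → ℤˣ,
          (C₁ * P) * (cap (signChange x ε) θ).indicator (fun y => ‖f y‖ₑ) y
          ∂weightedMeasure κ := by
        refine lintegral_mono fun y => ?_
        rcases eq_or_ne (capKernel κ x θ y) 0 with h | h
        · simp [h]
        · obtain ⟨ε, hε⟩ := exists_dist_signChange_le_of_capKernel_ne_zero hκ hr0 hcos h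
          have hmem : y ∈ cap (signChange x ε) θ := by
            rw [cap_eq_closedBall _ hθ.1.le hθ.2]; exact hε
          calc ‖f y‖ₑ * capKernel κ x θ y
              ≤ (C₁ * P) * (cap (signChange x ε) θ).indicator (fun y => ‖f y‖ₑ) y := by
                rw [indicator_of_mem hmem, mul_comm]
                gcongr
                exact hC₁ x y θ r hr0 hcos
            _ ≤ _ := Finset.single_le_sum
                (f := fun ε => (C₁ * P) * (cap (signChange x ε) θ).indicator (fun y => ‖f y‖ₑ) y)
                (fun _ _ => zero_le) (Finset.mem_univ ε)
    _ = ∑ ε : Fin (d + 1) → ℤˣ,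
          (C₁ * P) * ∫⁻ y in cap (signChange x ε) θ, ‖f y‖ₑ ∂weightedMeasure κ := by
        rw [lintegral_finsetSum' _ fun ε _ =>
          (hf.aestronglyMeasurable.enorm.indicator (hmeas _)).const_mul _]
        refine Finset.sum_congr rfl fun ε _ => ?_
        rw [lintegral_const_mul' _ _ (ENNReal.mul_ne_top ENNReal.coe_ne_top hPtop),
          lintegral_indicator (hmeas _)]
    _ ≤ ∑ ε : Fin (d + 1) → ℤˣ, (C₁ * P) * (hlMaximal κ f (signChange x ε) *
          (C₃ * weightedMeasure κ (Metric.closedBall x (r / 2)))) := by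
        gcongr with ε
        refine (setLIntegral_cap_le hκ f _ hθ.1 hθ.2).trans ?_
        rw [cap_eq_closedBall _ hθ.1.le hθ.2]
        gcongr
        exact hC₃ x _ (abs_signChange x ε) r hr0 hr2
    _ = C₁ * C₃ * (P * weightedMeasure κ (Metric.closedBall x (r / 2))) * S := by
        rw [← Finset.mul_sum, ← Finset.sum_mul]; ring
    _ ≤ C₁ * C₃ * (C₂ * D) * S := by gcongr
    _ = _ := by push_cast; ring

end ProductWeight

end

theorem mainTheorem5 {𝕜 : Type*} [RCLike 𝕜] (d : ℕ) (κ : Fin (d + 1) → ℝ) (hκ : ∀ i, 0 ≤ κ i) :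
    ∃ c : ℝ≥0, ∀ f : ProductWeight.Sph d → 𝕜,
      Integrable f (ProductWeight.weightedMeasure κ) → ∀ x : ProductWeight.Sph d,
        ProductWeight.intertwiningMaximal κ f x ≤
          c * ∑ ε : Fin (d + 1) → ℤˣ, ProductWeight.hlMaximal κ f (ProductWeight.signChange x ε) :=
  ProductWeight.intertwiningMaximal_le hκ
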